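/- Fix a positive integer $j$. A sequence $\{w_n\}_{n\ge j}$ of non-negative real numbers is a \emph{Hausdorff log-moment sequence} if there is a positive Borel measure $\mu$ concentrated on $[0,1]$ (a \emph{representing measure}) such that $\mu|_{(0,1]}$ is a Radon measure (locally finite and inner regular) on $(0,1]$ and $$w_n=\int_{[0,1]}t^{\log n}\,\mu(dt),\qquad n\ge j,$$ with the conventions $0^0=1$ and $0\cdot\infty=0$. A real sequence $\{a_n\}_{n\ge 0}$ is \emph{completely monotone} if $(-1)^k\Delta^k a_n\ge 0$ for all $k,n\ge 0$, where $\Delta a_n=a_{n+1}-a_n$; it is \emph{minimal} completely monotone if in addition, for every $\epsilon>0$, the sequence $a_0-\epsilon,a_1,a_2,\dots$ is not completely monotone. A \emph{representing measure} of a completely monotone sequence $\{a_n\}_{n\ge0}$ is a finite positive Borel measure $\nu$ concentrated on $[0,1]$ with $a_n=\int_{[0,1]}x^n\,\nu(dx)$ for all $n\ge 0$. Let $\{w_n\}_{n\ge j}$ be a Hausdorff log-moment sequence with a representing measure $\mu$. Then $\{w_{n+j}\}_{n\ge 0}$ is a completely monotone sequence. Moreover: (i) If $j=1$, then $\{w_{n+1}\}_{n\ge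 0}$ has exactly one representing measure $\nu$, and for every Borel set $\sigma\subseteq[0,1]$ $$\nu(\sigma)=\int_{[0,\infty)}\gamma_s\big(\psi^{-1}(\sigma\setminus\{0\})\big)\,\varphi_*\widehat\mu(ds)+\mu(\{0\})\,\delta_0(\sigma),$$ where $\varphi:(0,1]\to[0,\infty)$, $\varphi(t)=-\log t$; $\psi:[0,\infty)\to(0,1]$, $\psi(t)=e^{-t}$; $\widehat\mu(\sigma)=\mu(\sigma\setminus\{0\})$; $\varphi_*\widehat\mu$ is the push-forward of $\widehat\mu$ under $\varphi$; and $\gamma_s(dt)=\dfrac{t^{s-1}e^{-t}}{\Gamma(s)}\,dt$ on $[0,\infty)$ for $s>0$, while $\gamma_0=\delta_0$. (ii) If $j\ge 2$, then $\{w_{n+j}\}_{n\ge 0}$ is a minimal completely monotone sequence. -/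

import Mathlib

open MeasureTheory

namespace LogMoment

/-- A Radon measure: a locally finite, inner regular Borel measure. -/
def IsRadon {X : Type*} [TopologicalSpace X] [MeasurableSpace X] (μ : Measure X) : Prop :=
  IsLocallyFiniteMeasure μ ∧ μ.InnerRegular

/-- `μ` is a representing measure of the Hausdorff log-moment sequence `{w n}`, `n ≥ j`:
a positive Borel measure concentrated on `[0, 1]`, whose restriction to the space `(0, 1]` is a
Radon measure, with `w n = ∫ t ^ log n dμ(t)` for all `n ≥ j`. Here `0 ^ 0 = 1`, the mass of `{0}`
may be infinite, and the integral is taken in `[0, ∞]` with `0 * ∞ = 0`; the values `w n` with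
`n < j` play no role. -/
structure IsLogRepresentingMeasure (j : ℕ) (w : ℕ → ℝ) (μ : Measure ℝ) : Prop where
  concentrated : μ (Set.Icc 0 1)ᶜ = 0
  radon : IsRadon (μ.comap (Subtype.val : Set.Ioc (0 : ℝ) 1 → ℝ))
  moment : ∀ n : ℕ, j ≤ n →
    ENNReal.ofReal (w n) =
      ∫⁻ t in Set.Icc (0 : ℝ) 1, ENNReal.ofReal (t ^ Real.log (n : ℝ)) ∂μ

/-- `{w n}`, `n ≥ j`, is a Hausdorff log-moment sequence. -/
def IsHausdorffLogMomentSequence (j : ℕ) (w : ℕ → ℝ) : Prop :=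
  (∀ n : ℕ, j ≤ n → 0 ≤ w n) ∧ ∃ μ : Measure ℝ, IsLogRepresentingMeasure j w μ

/-- `{a n}`, `n ≥ 0`, is a completely monotone sequence: `(-1) ^ k * Δ ^ k a n ≥ 0` for all
`k, n ≥ 0`, where `Δ a n = a (n + 1) - a n`. -/
def IsCompletelyMonotoneSeq (a : ℕ → ℝ) : Prop :=
  ∀ k n : ℕ, 0 ≤ (-1 : ℝ) ^ k * (fwdDiff 1)^[k] a n

/-- A completely monotone sequence is minimal if it is no longer completely monotone once its
zeroth term is decreased by any positive amount. -/
def IsMinimalCompletelyMonotoneSeq (a : ℕ → ℝ) : Prop :=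
  IsCompletelyMonotoneSeq a ∧
    ∀ ε : ℝ, 0 < ε → ¬ IsCompletelyMonotoneSeq (fun n => a n - if n = 0 then ε else 0)

/-- `ν` is a representing measure of the completely monotone sequence `{a n}`, `n ≥ 0`: a finite
Borel measure concentrated on `[0, 1]` with `a n = ∫ x ^ n dν(x)` for all `n ≥ 0`. -/
structure IsRepresentingMeasure (a : ℕ → ℝ) (ν : Measure ℝ) : Prop where
  finite : IsFiniteMeasure ν
  concentrated : ν (Set.Icc 0 1)ᶜ = 0
  moment : ∀ n : ℕ, a n = ∫ x in Set.Icc (0 : ℝ) 1, x ^ n ∂ν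

/-- The measure `σ ↦ μ (σ \ {0})`. -/
noncomputable def muHat (μ : Measure ℝ) : Measure ℝ := μ.restrict {0}ᶜ

/-- The push-forward to `[0, ∞)` of a measure under `φ : (0, 1] → [0, ∞)`, `φ t = - log t`. -/
noncomputable def phiPush (μ : Measure ℝ) : Measure ℝ :=
  (μ.restrict (Set.Ioc 0 1)).map (fun t => -Real.log t)

/-- The preimage of `A` under `ψ : [0, ∞) → (0, 1]`, `ψ t = e ^ (-t)`. -/
def psiPreimage (A : Set ℝ) : Set ℝ := {t | 0 ≤ t ∧ Real.exp (-t) ∈ A}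

/-- The measure `t ^ (s - 1) * e ^ (-t) / Γ(s) dt` on `[0, ∞)` for `s > 0`, and the unit mass at `0`
for `s = 0`. -/
noncomputable def gammaKernel (s : ℝ) : Measure ℝ :=
  if s = 0 then Measure.dirac 0
  else (volume.restrict (Set.Ici 0)).withDensity
    (fun t => ENNReal.ofReal (t ^ (s - 1) * Real.exp (-t) / Real.Gamma s))

end LogMoment

open Set Filter Topology

namespace LogMoment

/-! ### Complete monotonicity and minimality from a representing measure -/

section CompletelyMonotone

/-! Put `t = exp (-s)` in `(0, 1]`: then `t ^ log (n + 1) = (n + 1) ^ (-s)`, which is the Laplace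
transform at `n` of the gamma law of shape `s`. Averaging these laws over `μ` and substituting `x =
exp (-t)` gives `gammaMixture μ`, whose `n`-th moment is the integral over `(0, 1]` of `t ^ log (n +
1)` against `μ` (`lintegral_pow_gammaMixture`). The atom of `μ` at `0` contributes only to `w 1`.

For `j = 1`, adding that atom gives the representing measure, unique by Weierstrass approximation.
For `j ≥ 2`, the mixture weighted by `x ^ (j - 1)` represents the sequence and has no mass at `0`.
Minimality follows: the signed differences at `0` are the integrals of `(1 - x) ^ k`, which tend to
`0`, while lowering the zeroth term by `ε` lowers each of them by `ε`. -/

theorem integrable_of_continuousOn_Icc {ν : Measure ℝ} [IsFiniteMeasure ν] {f : ℝ → ℝ}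
    (hf : ContinuousOn f (Icc 0 1)) : IntegrableOn f (Icc 0 1) ν :=
  hf.integrableOn_compact isCompact_Icc

/-- Each signed difference multiplies the integrand by `1 - x`. -/
theorem IsRepresentingMeasure.neg_one_pow_mul_fwdDiff_iter {a : ℕ → ℝ} {ν : Measure ℝ}
    (h : IsRepresentingMeasure a ν) (k n : ℕ) :
    (-1 : ℝ) ^ k * (fwdDiff 1)^[k] a n = ∫ x in Icc (0 : ℝ) 1, x ^ n * (1 - x) ^ k ∂ν := by
  have := h.finite
  induction k generalizing n with
  | zero => simpa using h.moment n
  | succ k ih =>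
    have e : (-1 : ℝ) ^ (k + 1) * (fwdDiff 1)^[k + 1] a n
        = (-1 : ℝ) ^ k * (fwdDiff 1)^[k] a n - (-1 : ℝ) ^ k * (fwdDiff 1)^[k] a (n + 1) := by
      rw [Function.iterate_succ_apply', fwdDiff]
      ring
    rw [e, ih, ih, ← integral_sub]
    · congr 1
      ext x
      ring
    · exact integrable_of_continuousOn_Icc (by fun_prop)
    · exact integrable_of_continuousOn_Icc (by fun_prop)

theorem IsRepresentingMeasure.isCompletelyMonotoneSeq {a : ℕ → ℝ} {ν : Measure ℝ}
    (h : IsRepresentingMeasure a ν) : IsCompletelyMonotoneSeq a := by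
  intro k n
  rw [h.neg_one_pow_mul_fwdDiff_iter]
  refine setIntegral_nonneg measurableSet_Icc fun x hx => ?_
  have := hx.1
  have : 0 ≤ 1 - x := by linarith [hx.2]
  positivity

theorem fwdDiff_iter_ite_zero (ε : ℝ) (k n : ℕ) :
    (fwdDiff 1)^[k] (fun n : ℕ => if n = 0 then ε else 0) n
      = if n = 0 then (-1 : ℝ) ^ k * ε else 0 := by
  induction k generalizing n with
  | zero => simp
  | succ k ih =>
    rw [Function.iterate_succ_apply', fwdDiff, ih, ih]
    rcases eq_or_ne n 0 with rfl | hn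
    · simp
      ring
    · simp [hn]

/-- If the representing measure has no mass at `0`, the `k`-th differences at `0` tend to `0`. -/
theorem IsRepresentingMeasure.tendsto_fwdDiff_iter_zero {a : ℕ → ℝ} {ν : Measure ℝ}
    (h : IsRepresentingMeasure a ν) (h0 : ν {0} = 0) :
    Tendsto (fun k : ℕ => (-1 : ℝ) ^ k * (fwdDiff 1)^[k] a 0) atTop (𝓝 0) := by
  have := h.finite
  simp_rw [h.neg_one_pow_mul_fwdDiff_iter, pow_zero, one_mul]
  suffices hlim : Tendsto (fun k : ℕ => ∫ x in Icc (0 : ℝ) 1, (1 - x) ^ k ∂ν) atTop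
      (𝓝 (∫ _ in Icc (0 : ℝ) 1, (0 : ℝ) ∂ν)) by simpa using hlim
  have hmem : ∀ᵐ x ∂(ν.restrict (Icc (0 : ℝ) 1)), x ∈ Icc (0 : ℝ) 1 :=
    ae_restrict_mem measurableSet_Icc
  have hne : ∀ᵐ x ∂(ν.restrict (Icc (0 : ℝ) 1)), x ≠ 0 :=
    ae_restrict_of_ae (measure_eq_zero_iff_ae_notMem.1 h0)
  refine tendsto_integral_of_dominated_convergence (fun _ => (1 : ℝ)) (fun k => ?_)
    (integrable_const _) (fun k => ?_) ?_
  · exact Continuous.aestronglyMeasurable (by fun_prop)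
  · filter_upwards [hmem] with x hx
    rw [norm_pow, Real.norm_eq_abs]
    exact pow_le_one₀ (abs_nonneg _) (abs_le.2 ⟨by linarith [hx.2], by linarith [hx.1]⟩)
  · filter_upwards [hmem, hne] with x hx hx0
    have : 0 < x := lt_of_le_of_ne hx.1 (Ne.symm hx0)
    exact tendsto_pow_atTop_nhds_zero_of_lt_one (by linarith [hx.2]) (by linarith)

theorem IsRepresentingMeasure.isMinimalCompletelyMonotoneSeq {a : ℕ → ℝ} {ν : Measure ℝ}
    (h : IsRepresentingMeasure a ν) (h0 : ν {0} = 0) : IsMinimalCompletelyMonotoneSeq a := by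
  refine ⟨h.isCompletelyMonotoneSeq, fun ε hε hcm => ?_⟩
  have hk : ∀ k : ℕ, ε ≤ (-1 : ℝ) ^ k * (fwdDiff 1)^[k] a 0 := by
    intro k
    have h1 := hcm k 0
    have h2 : (fun n => a n - if n = 0 then ε else 0)
        = a + (fun n : ℕ => if n = 0 then -ε else 0) := by
      ext n
      by_cases hn : n = 0 <;> simp [hn, sub_eq_add_neg]
    rw [h2, fwdDiff_iter_add, Pi.add_apply, fwdDiff_iter_ite_zero, mul_add, if_pos rfl,
      ← mul_assoc, ← mul_pow] at h1
    norm_num at h1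
    linarith
  exact absurd (ge_of_tendsto' (h.tendsto_fwdDiff_iter_zero h0) hk) (not_le.2 hε)

end CompletelyMonotone

/-! ### Uniqueness of the representing measure -/

section Uniqueness

theorem IsRepresentingMeasure.restrict_eq {a : ℕ → ℝ} {ν : Measure ℝ}
    (h : IsRepresentingMeasure a ν) : ν.restrict (Icc 0 1) = ν :=
  Measure.restrict_eq_self_of_ae_mem (mem_ae_iff.2 h.concentrated)

theorem IsRepresentingMeasure.integral_polynomial {a : ℕ → ℝ} {ν : Measure ℝ}
    (h : IsRepresentingMeasure a ν) (p : Polynomial ℝ) :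
    ∫ x in Icc (0 : ℝ) 1, p.eval x ∂ν = p.sum fun n c => c * a n := by
  have := h.finite
  simp_rw [Polynomial.eval_eq_sum, Polynomial.sum]
  rw [integral_finsetSum _ fun n _ => integrable_of_continuousOn_Icc (by fun_prop)]
  refine Finset.sum_congr rfl fun n _ => ?_
  rw [integral_const_mul, h.moment]

theorem abs_integral_sub_le {ν : Measure ℝ} [IsFiniteMeasure ν] {f g : ℝ → ℝ}
    (hf : Continuous f) (hg : Continuous g) {ε : ℝ}
    (h : ∀ x ∈ Icc (0 : ℝ) 1, |g x - f x| < ε) :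
    |(∫ x in Icc (0 : ℝ) 1, g x ∂ν) - ∫ x in Icc (0 : ℝ) 1, f x ∂ν| ≤ ε * ν.real (Icc 0 1) := by
  rw [← integral_sub (integrable_of_continuousOn_Icc hg.continuousOn)
    (integrable_of_continuousOn_Icc hf.continuousOn)]
  exact norm_setIntegral_le_of_norm_le_const (f := fun x => g x - f x) (measure_lt_top _ _)
    fun x hx => (h x hx).le

/-- A completely monotone sequence determines its representing measure. -/
theorem IsRepresentingMeasure.unique {a : ℕ → ℝ} {ν ν' : Measure ℝ}
    (h : IsRepresentingMeasure a ν) (h' : IsRepresentingMeasure a ν') : ν = ν' := by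
  have := h.finite
  have := h'.finite
  refine ext_of_forall_integral_eq_of_IsFiniteMeasure fun f => ?_
  rw [← h.restrict_eq, ← h'.restrict_eq]
  set M := ν.real (Icc 0 1) + ν'.real (Icc 0 1) with hM
  have hM0 : 0 ≤ M := by positivity
  refine eq_of_abs_sub_le_all fun ε hε => ?_
  -- The two approximation errors add up to at most `ε / (M + 1) * M ≤ ε`; the `+ 1` covers `M = 0`.
  obtain ⟨p, hp⟩ := exists_polynomial_near_of_continuousOn 0 1 f f.continuous.continuousOn
    (ε / (M + 1)) (by positivity)
  have h1 := abs_integral_sub_le (ν := ν) f.continuous p.continuous hp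
  have h2 := abs_integral_sub_le (ν := ν') f.continuous p.continuous hp
  rw [h.integral_polynomial] at h1
  rw [h'.integral_polynomial] at h2
  have h3 : ε / (M + 1) * M ≤ ε := by
    rw [div_mul_eq_mul_div, div_le_iff₀ (by positivity)]
    nlinarith
  rw [hM, mul_add] at h3
  rw [abs_le] at *
  constructor <;> linarith [h1.1, h1.2, h2.1, h2.2]

/-- Finiteness of `ν` comes for free: its total mass is the moment of order `0`. -/
theorem IsRepresentingMeasure.of_lintegral {a : ℕ → ℝ} {ν : Measure ℝ} (ha : ∀ n, 0 ≤ a n)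
    (hν : ν (Icc 0 1)ᶜ = 0)
    (h : ∀ n, ENNReal.ofReal (a n) = ∫⁻ x, ENNReal.ofReal (x ^ n) ∂ν) :
    IsRepresentingMeasure a ν := by
  have hr : ν.restrict (Icc 0 1) = ν :=
    Measure.restrict_eq_self_of_ae_mem (mem_ae_iff.2 hν)
  refine ⟨⟨?_⟩, hν, fun n => ?_⟩
  · have := h 0
    simp only [pow_zero, ENNReal.ofReal_one, lintegral_one] at this
    rw [← this]
    exact ENNReal.ofReal_lt_top
  · rw [hr, integral_eq_lintegral_of_nonneg_ae, ← h, ENNReal.toReal_ofReal (ha n)]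
    · filter_upwards [mem_ae_iff.2 hν] with x hx
      exact pow_nonneg hx.1 n
    · exact Continuous.aestronglyMeasurable (by fun_prop)

end Uniqueness

/-! ### Mixtures of gamma laws and their moments -/

section GammaMixture

/-- The kernel `gammaKernel`, continued to `s < 0` by the unit mass at `0`. -/
noncomputable def gammaKernelExt (s : ℝ) : Measure ℝ :=
  if 0 < s then gammaKernel s else Measure.dirac 0

theorem gammaKernelExt_of_nonneg {s : ℝ} (hs : 0 ≤ s) : gammaKernelExt s = gammaKernel s := by
  rcases hs.eq_or_lt with rfl | hs
  · simp [gammaKernelExt, gammaKernel]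
  · rw [gammaKernelExt, if_pos hs]

/-- Cutting off at `s ≤ 0` avoids the poles, so continuity on `s > 0` suffices. -/
theorem measurable_piecewise_Gamma :
    Measurable (Set.piecewise (Ioi (0 : ℝ)) Real.Gamma fun _ => 0) := by
  refine ContinuousOn.measurable_piecewise (fun s hs => ?_) continuousOn_const measurableSet_Ioi
  refine (Real.differentiableAt_Gamma fun m => ?_).continuousAt.continuousWithinAt
  have : (0 : ℝ) < s := hs
  have : (0 : ℝ) ≤ m := m.cast_nonneg
  linarith

/-- `Measure.bind` is applied to a kernel on all of `ℝ`, although the mixing measure lives on `[0,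
∞)`; this is the purpose of the extension. -/
theorem measurable_gammaKernelExt : Measurable gammaKernelExt := by
  refine Measure.measurable_of_measurable_coe _ fun A hA => ?_
  have key : Measurable fun s : ℝ => ∫⁻ t in A ∩ Ici 0,
      ENNReal.ofReal (t ^ (s - 1) * Real.exp (-t) /
        Set.piecewise (Ioi (0 : ℝ)) Real.Gamma (fun _ => 0) s) := by
    refine Measurable.lintegral_prod_right' (f := fun z : ℝ × ℝ =>
      ENNReal.ofReal (z.2 ^ (z.1 - 1) * Real.exp (-z.2) /
        Set.piecewise (Ioi (0 : ℝ)) Real.Gamma (fun _ => 0) z.1)) ?_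
    have := measurable_piecewise_Gamma.comp (measurable_fst : Measurable (Prod.fst : ℝ × ℝ → ℝ))
    refine ENNReal.measurable_ofReal.comp (Measurable.div ?_ this)
    fun_prop
  have e : (fun s => gammaKernelExt s A) = fun s => if 0 < s then ∫⁻ t in A ∩ Ici 0,
      ENNReal.ofReal (t ^ (s - 1) * Real.exp (-t) /
        Set.piecewise (Ioi (0 : ℝ)) Real.Gamma (fun _ => 0) s)
      else Measure.dirac (0 : ℝ) A := by
    ext s
    by_cases hs : 0 < s
    · rw [gammaKernelExt, if_pos hs, if_pos hs, gammaKernel, if_neg hs.ne',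
        withDensity_apply _ hA, Measure.restrict_restrict hA,
        Set.piecewise_eq_of_mem _ _ _ (show s ∈ Ioi 0 from hs)]
    · rw [gammaKernelExt, if_neg hs, if_neg hs]
  rw [e]
  exact Measurable.ite measurableSet_Ioi key measurable_const

/-- The Laplace transform of the gamma kernel at an integer. -/
theorem lintegral_exp_pow_gammaKernel {s : ℝ} (hs : 0 ≤ s) (n : ℕ) :
    ∫⁻ t, ENNReal.ofReal (Real.exp (-t) ^ n) ∂(gammaKernel s)
      = ENNReal.ofReal (((n + 1 : ℕ) : ℝ) ^ (-s)) := by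
  rcases hs.eq_or_lt with rfl | hs
  · simp [gammaKernel, lintegral_dirac]
  · rw [gammaKernel, if_neg hs.ne', lintegral_withDensity_eq_lintegral_mul _ (by fun_prop)
      (by fun_prop)]
    have hn : (0 : ℝ) < ((n + 1 : ℕ) : ℝ) := by positivity
    have hΓ := Real.Gamma_pos_of_pos hs
    -- Up to the factor `(n + 1) ^ (-s)`, the integrand is the gamma density of shape `s` and rate
    -- `n + 1`, of total mass `1`.
    have e : ∀ t : ℝ, (Ici (0 : ℝ)).indicator ((fun t => ENNReal.ofReal (t ^ (s - 1) * Real.exp (-t)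
        / Real.Gamma s)) * fun t => ENNReal.ofReal (Real.exp (-t) ^ n)) t
        = ENNReal.ofReal (((n + 1 : ℕ) : ℝ) ^ (-s))
          * ProbabilityTheory.gammaPDF s ((n + 1 : ℕ) : ℝ) t := by
      intro t
      by_cases ht : 0 ≤ t
      · rw [indicator_of_mem (show t ∈ Ici 0 from ht), Pi.mul_apply,
          ProbabilityTheory.gammaPDF_of_nonneg ht, ← ENNReal.ofReal_mul (by positivity),
          ← ENNReal.ofReal_mul (by positivity), Real.rpow_neg hn.le, ← Real.exp_nat_mul]
        congr 1
        have h1 : Real.exp (-(((n + 1 : ℕ) : ℝ) * t)) = Real.exp (-t) * Real.exp (n * -t) := by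
          rw [← Real.exp_add]
          congr 1
          push_cast
          ring
        have h2 : (((n + 1 : ℕ) : ℝ) ^ s) ≠ 0 := (Real.rpow_pos_of_pos hn s).ne'
        rw [h1]
        field_simp
      · rw [indicator_of_notMem (show t ∉ Ici 0 from ht),
          ProbabilityTheory.gammaPDF_of_neg (not_le.1 ht), mul_zero]
    rw [← lintegral_indicator measurableSet_Ici, lintegral_congr e, lintegral_const_mul' _ _
      ENNReal.ofReal_ne_top, ProbabilityTheory.lintegral_gammaPDF_eq_one hs hn, mul_one]

/-- The image under `t ↦ exp (-t)` of the mixture of gamma distributions with weights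
`phiPush (muHat μ)`. -/
noncomputable def gammaMixture (μ : Measure ℝ) : Measure ℝ :=
  (((phiPush (muHat μ)).restrict (Ici 0)).bind gammaKernelExt).map fun t => Real.exp (-t)

theorem measurable_exp_neg : Measurable fun t : ℝ => Real.exp (-t) := by fun_prop

theorem gammaMixture_apply (μ : Measure ℝ) {σ : Set ℝ} (hσ : MeasurableSet σ) :
    gammaMixture μ σ = ∫⁻ s in Ici (0 : ℝ), gammaKernel s ((fun t => Real.exp (-t)) ⁻¹' σ)
      ∂(phiPush (muHat μ)) := by
  rw [gammaMixture, Measure.map_apply measurable_exp_neg hσ,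
    Measure.bind_apply (measurable_exp_neg hσ) measurable_gammaKernelExt.aemeasurable]
  exact setLIntegral_congr_fun measurableSet_Ici fun s hs => by
    simp only [gammaKernelExt_of_nonneg hs]

theorem gammaMixture_apply_of_subset (μ : Measure ℝ) {σ : Set ℝ} (hσ : MeasurableSet σ)
    (h : σ ⊆ Icc 0 1) :
    gammaMixture μ σ = ∫⁻ s in Ici (0 : ℝ), gammaKernel s (psiPreimage (σ \ {0}))
      ∂(phiPush (muHat μ)) := by
  rw [gammaMixture_apply μ hσ]
  -- Since `σ ⊆ [0, 1]`, the condition `exp (-t) ∈ σ` already forces `t ≥ 0`.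
  suffices e : (fun t : ℝ => Real.exp (-t)) ⁻¹' σ = psiPreimage (σ \ {0}) by rw [e]
  ext t
  change Real.exp (-t) ∈ σ ↔ 0 ≤ t ∧ Real.exp (-t) ∈ σ ∧ Real.exp (-t) ≠ 0
  refine ⟨fun ht => ⟨?_, ht, (Real.exp_pos _).ne'⟩, fun ht => ht.2.1⟩
  have := (h ht).2
  rw [Real.exp_le_one_iff] at this
  linarith

theorem gammaMixture_singleton_zero (μ : Measure ℝ) : gammaMixture μ {0} = 0 := by
  rw [gammaMixture, Measure.map_apply measurable_exp_neg (measurableSet_singleton _)]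
  have e : (fun t : ℝ => Real.exp (-t)) ⁻¹' {0} = ∅ := by
    ext t
    simp
  rw [e, measure_empty]

theorem gammaKernel_Iio_zero (s : ℝ) : gammaKernel s (Iio 0) = 0 := by
  rw [gammaKernel]
  split_ifs
  · simp
  · refine withDensity_absolutelyContinuous _ _ ?_
    rw [Measure.restrict_apply measurableSet_Iio, Iio_inter_Ici, Ico_self, measure_empty]

theorem gammaMixture_compl_Icc (μ : Measure ℝ) : gammaMixture μ (Icc 0 1)ᶜ = 0 := by
  rw [gammaMixture_apply μ measurableSet_Icc.compl]
  have e : (fun t : ℝ => Real.exp (-t)) ⁻¹' (Icc 0 1)ᶜ = Iio 0 := by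
    ext t
    simp [Real.exp_nonneg]
  simp [e, gammaKernel_Iio_zero]

theorem lintegral_pow_gammaMixture (μ : Measure ℝ) (n : ℕ) :
    ∫⁻ x, ENNReal.ofReal (x ^ n) ∂(gammaMixture μ)
      = ∫⁻ t in Ioc (0 : ℝ) 1, ENNReal.ofReal (t ^ Real.log ((n + 1 : ℕ) : ℝ)) ∂μ := by
  have hsub : Ioc (0 : ℝ) 1 ∩ {0}ᶜ = Ioc 0 1 :=
    inter_eq_left.2 fun t ht => ht.1.ne'
  have hpre : (fun t : ℝ => -Real.log t) ⁻¹' Ici 0 ∩ Ioc 0 1 = Ioc 0 1 :=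
    inter_eq_right.2 fun t ht => by
      simpa using Real.log_nonpos ht.1.le ht.2
  have hmeas : Measurable fun t : ℝ => -Real.log t := by fun_prop
  rw [gammaMixture, lintegral_map (by fun_prop) measurable_exp_neg,
    Measure.lintegral_bind measurable_gammaKernelExt.aemeasurable
      (Measurable.aemeasurable (by fun_prop)),
    setLIntegral_congr_fun measurableSet_Ici 
      (g := fun s => ENNReal.ofReal (((n + 1 : ℕ) : ℝ) ^ (-s)))
      fun s hs => by
        simp only [gammaKernelExt_of_nonneg hs]
        exact lintegral_exp_pow_gammaKernel hs n,
    phiPush, muHat, Measure.restrict_restrict measurableSet_Ioc, hsub,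
    setLIntegral_map measurableSet_Ici (by fun_prop) hmeas,
    Measure.restrict_restrict (hmeas measurableSet_Ici), hpre]
  refine setLIntegral_congr_fun measurableSet_Ioc fun t ht => ?_
  have hn : (0 : ℝ) < ((n + 1 : ℕ) : ℝ) := by positivity
  simp only [neg_neg]
  rw [Real.rpow_def_of_pos hn, Real.rpow_def_of_pos ht.1, mul_comm]

end GammaMixture

/-! ### Representing measures for the shifted sequence -/

theorem IsLogRepresentingMeasure.ofReal_eq {j : ℕ} {w : ℕ → ℝ} {μ : Measure ℝ}
    (h : IsLogRepresentingMeasure j w μ) {n : ℕ} (hn : j ≤ n + 1) :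
    ENNReal.ofReal (w (n + 1)) = ∫⁻ x, ENNReal.ofReal (x ^ n) ∂(gammaMixture μ)
      + ENNReal.ofReal ((0 : ℝ) ^ n) * μ {0} := by
  rw [h.moment _ hn, lintegral_pow_gammaMixture,
    ← Ioc_union_left (show (0 : ℝ) ≤ 1 from zero_le_one),
    lintegral_union (measurableSet_singleton _) (by simp), lintegral_singleton]
  -- `log (n + 1)` vanishes exactly when `n = 0`, so `0 ^ log (n + 1) = 0 ^ n`.
  congr 3
  rcases eq_or_ne n 0 with rfl | h0
  · simp
  · rw [zero_pow h0, Real.zero_rpow]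
    refine (Real.log_pos ?_).ne'
    have : 0 < n := Nat.pos_of_ne_zero h0
    exact_mod_cast Nat.lt_add_of_pos_left this

theorem IsLogRepresentingMeasure.isRepresentingMeasure_one {w : ℕ → ℝ} {μ : Measure ℝ}
    (h : IsLogRepresentingMeasure 1 w μ) (hw : ∀ n, 1 ≤ n → 0 ≤ w n) :
    IsRepresentingMeasure (fun n => w (n + 1)) (gammaMixture μ + μ {0} • Measure.dirac 0) := by
  refine .of_lintegral (fun n => hw _ (by omega)) ?_ fun n => ?_
  · simp [gammaMixture_compl_Icc]
  · rw [h.ofReal_eq (by omega), lintegral_add_measure, lintegral_smul_measure, lintegral_dirac,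
      smul_eq_mul, mul_comm (μ {0})]

/-- The mixture itself may have infinite mass; the weight absorbs the shift by `j - 1 ≥ 1`, and the
atom at `0`, even if infinite, is multiplied by `0`. -/
theorem IsLogRepresentingMeasure.isRepresentingMeasure_withDensity {j : ℕ} (hj : 2 ≤ j)
    {w : ℕ → ℝ} {μ : Measure ℝ} (h : IsLogRepresentingMeasure j w μ)
    (hw : ∀ n, j ≤ n → 0 ≤ w n) :
    IsRepresentingMeasure (fun n => w (n + j))
      ((gammaMixture μ).withDensity fun x => ENNReal.ofReal (x ^ (j - 1))) := by
  refine .of_lintegral (fun n => hw _ (by omega))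
    (withDensity_absolutelyContinuous _ _ (gammaMixture_compl_Icc μ)) fun n => ?_
  obtain ⟨i, rfl⟩ : ∃ i, j = i + 1 := ⟨j - 1, by omega⟩
  rw [← add_assoc, h.ofReal_eq (by omega), zero_pow (by omega), ENNReal.ofReal_zero, zero_mul,
    add_zero, lintegral_withDensity_eq_lintegral_mul _ (by fun_prop) (by fun_prop)]
  refine lintegral_congr_ae ?_
  filter_upwards [mem_ae_iff.2 (gammaMixture_compl_Icc μ)] with x hx
  rw [Pi.mul_apply, ← ENNReal.ofReal_mul (pow_nonneg hx.1 _), Nat.add_sub_cancel, ← pow_add,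
    add_comm]

end LogMoment

theorem mainTheorem6 (j : ℕ) (hj : 1 ≤ j) (w : ℕ → ℝ)
    (hw : LogMoment.IsHausdorffLogMomentSequence j w)
    (μ : Measure ℝ) (hμ : LogMoment.IsLogRepresentingMeasure j w μ) :
    LogMoment.IsCompletelyMonotoneSeq (fun n => w (n + j)) ∧
    (j = 1 →
      ∃ ν : Measure ℝ,
        LogMoment.IsRepresentingMeasure (fun n => w (n + 1)) ν ∧
        (∀ ν' : Measure ℝ,
          LogMoment.IsRepresentingMeasure (fun n => w (n + 1)) ν' → ν' = ν) ∧
        ∀ σ : Set ℝ, MeasurableSet σ → σ ⊆ Set.Icc 0 1 →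
          ν σ =
            (∫⁻ s in Set.Ici (0 : ℝ),
              LogMoment.gammaKernel s (LogMoment.psiPreimage (σ \ {0}))
                ∂(LogMoment.phiPush (LogMoment.muHat μ)))
            + μ {0} * Measure.dirac (0 : ℝ) σ) ∧
    (2 ≤ j → LogMoment.IsMinimalCompletelyMonotoneSeq (fun n => w (n + j))) := by
  have hmin : 2 ≤ j → LogMoment.IsMinimalCompletelyMonotoneSeq (fun n => w (n + j)) := fun h2 =>
    (hμ.isRepresentingMeasure_withDensity h2 hw.1).isMinimalCompletelyMonotoneSeq
      (withDensity_absolutelyContinuous _ _ (LogMoment.gammaMixture_singleton_zero μ))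
  refine ⟨?_, ?_, hmin⟩
  · rcases hj.eq_or_lt with rfl | h2
    · exact (hμ.isRepresentingMeasure_one hw.1).isCompletelyMonotoneSeq
    · exact (hmin h2).1
  · rintro rfl
    have hν := hμ.isRepresentingMeasure_one hw.1
    refine ⟨_, hν, fun ν' hν' => hν'.unique hν, fun σ hσ hsub => ?_⟩
    rw [Measure.add_apply, LogMoment.gammaMixture_apply_of_subset μ hσ hsub, Measure.smul_apply,
      smul_eq_mul]
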